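/- Let $n\ge 1$. For an open interval $\emptyset\ne J\subseteq(0,\infty)$ let $M_J=\{z\in\mathbb C^n: |z|^2\in J\}$, so $M_{(0,\infty)}=\mathbb C^n\setminus\{0\}$. For a smooth function $f:J\to\mathbb R$ put $s=|z|^2$ and regard $f(s)$ as a function on $M_J$; it is a Kähler potential if the matrix $\big(\partial^2 f(s)/\partial z_i\partial\bar z_j\big)$ is positive definite on $M_J$, and then $\omega=2i\,\partial\bar\partial f$ is the Kähler form of a Kähler metric on $M_J$. The scalar curvature $S$ of this metric is the trace of its Ricci form $\Theta$ with respect to $\omega$, i.e. $S\,\omega^n=n\,\Theta\wedge\omega^{n-1}$. In the coordinates $z_j=e^{a_j+ib_j}$ the function $f(s)$ depends only on $a$. A smooth function $g$ on an open set $P\subseteq\mathbb R^n$ is the symplectic potential of the metric if the Legendre transform $a\mapsto x=(\partial f/\partial a_1,\dots,\partial f/\partial a_n)$ is a bijection from $\{a:(e^{a_1},\dots,e^{a_n})\in M_J\}$ onto $P$ with inverse $x\mapsto dg_x=a$, and $f(a)+g(x)=\sum_i\frac{\partial f}{\partial a_i}\frac{\partial g}{\partial x_i}$. For $I\subseteq(0,\infty)$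 let $P_I=\{x\in\mathbb R^n: x_i>0 \text{ for all } i,\ \sum_i x_i\in I\}$. (1) Let $f(s)$ be a Kähler potential on $M_J$; if $n=1$, assume also $f'>0$ (for $n\ge2$ this is automatic). Then the metric is $\mathrm{SU}(n)$-invariant; $s\mapsto t=2sf'(s)$ is a bijection of $J$ onto an open interval $I\subseteq(0,\infty)$ with smooth inverse $s(t)$; and with $$F(t)=t\ln\frac{s(t)}{t}-2f(s(t)),\qquad t\in I,$$ $F$ is smooth, $F''(t)>-1/t$ on $I$, and the metric has the symplectic potential $$g(x)=\tfrac12\Big[\sum_{i=1}^n x_i\ln x_i+F(t)\Big],\qquad t=\sum_{i=1}^n x_i=2sf'(s),$$ on $P_I$. Its scalar curvature at every point of $M_J$ is $$S=t^{1-n}\left(\frac{t^{n+1}F''}{1+tF''}\right)'',\qquad t=2sf'(s).$$ (2) Conversely, let $f:J\to\mathbb R$ be any smooth function for which $s\mapsto t=2sf'(s)$ is injective with image $I\subseteq(0,\infty)$. If the function $F(t)=t\ln(s(t)/t)-2f(s(t))$ is smooth on $I$ and $F''(t)>-1/t$ there, then $f(s)$ is a Kähler potential on $M_J$. (3) More generally,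 let $F$ be any smooth function on an open interval $\emptyset\ne I\subseteq(0,\infty)$ with $F''(t)>-1/t$. Then $J=\{te^{1+F'(t)}:t\in I\}$ is an open interval in $(0,\infty)$, and there is a smooth $f:J\to\mathbb R$ such that $f(s)$ is the Kähler potential of an $\mathrm{SU}(n)$-invariant Kähler metric on $M_J$ with symplectic potential $g(x)=\frac12\big[\sum_i x_i\ln x_i+F(\sum_i x_i)\big]$ on $P_I$; moreover $2sf'(s)$ has range $I$ on $J$ and $F(t)=t\ln(s(t)/t)-2f(s(t))$. Both $J$ and $f$ are uniquely determined by $g$ on $P_I$. In particular the metric lives on $\mathbb C^n\setminus\{0\}$ exactly when $te^{1+F'(t)}$ takes all positive values on $I$. -/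

import Mathlib

open scoped ComplexOrder ContDiff

noncomputable section

namespace ToricKahler

variable {n : ℕ}

/-! ### Kähler metrics on open subsets of `ℂⁿ` given by a Kähler potential -/

/-- The Wirtinger derivative `∂/∂z_i = (∂/∂x_i - i ∂/∂y_i) / 2`. -/
def dZ (i : Fin n) (φ : (Fin n → ℂ) → ℂ) (z : Fin n → ℂ) : ℂ :=
  (fderiv ℝ φ z (Pi.single i 1) - Complex.I * fderiv ℝ φ z (Pi.single i Complex.I)) / 2

/-- The Wirtinger derivative `∂/∂z̄_i = (∂/∂x_i + i ∂/∂y_i) / 2`. -/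
def dZbar (i : Fin n) (φ : (Fin n → ℂ) → ℂ) (z : Fin n → ℂ) : ℂ :=
  (fderiv ℝ φ z (Pi.single i 1) + Complex.I * fderiv ℝ φ z (Pi.single i Complex.I)) / 2

/-- The complex Hessian `(∂²φ / ∂z_i ∂z̄_j)_{ij}` of a real function. -/
def complexHessian (φ : (Fin n → ℂ) → ℝ) (z : Fin n → ℂ) : Matrix (Fin n) (Fin n) ℂ :=
  Matrix.of fun i j => dZ i (fun w => dZbar j (fun u => (φ u : ℂ)) w) z

/-- `φ` is a Kähler potential on `U`: it is smooth and its complex Hessian is positive definite,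
so that `ω = 2i ∂∂̄φ` is the Kähler form of a Kähler metric `ω(·, J·)` on `U`, where `J` is the
standard complex structure. -/
def IsKahlerPotentialOn (φ : (Fin n → ℂ) → ℝ) (U : Set (Fin n → ℂ)) : Prop :=
  ContDiffOn ℝ ∞ φ U ∧ ∀ z ∈ U, (complexHessian φ z).PosDef

/-- The matrix `H` of the Kähler form: `ω = 2i ∂∂̄φ = i ∑ H_{ij} dz_i ∧ dz̄_j`. -/
def kahlerMatrix (φ : (Fin n → ℂ) → ℝ) (z : Fin n → ℂ) : Matrix (Fin n) (Fin n) ℂ :=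
  (2 : ℂ) • complexHessian φ z

/-- The matrix `R` of the Ricci form: `Θ = -i ∂∂̄ log det H = i ∑ R_{ij} dz_i ∧ dz̄_j`. -/
def ricciMatrix (φ : (Fin n → ℂ) → ℝ) (z : Fin n → ℂ) : Matrix (Fin n) (Fin n) ℂ :=
  -complexHessian (fun w => Real.log (kahlerMatrix φ w).det.re) z

/-- The scalar curvature of the Kähler metric with Kähler form `ω = 2i ∂∂̄φ`: the trace of the
Ricci form with respect to the Kähler form, i.e. the `S` with `S ω^n = n Θ ∧ ω^(n-1)`.
(This is half the Riemannian scalar curvature of `ω(·, J·)`.) -/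
def scalarCurvature (φ : (Fin n → ℂ) → ℝ) (z : Fin n → ℂ) : ℂ :=
  ((kahlerMatrix φ z)⁻¹ * ricciMatrix φ z).trace

/-- The Kähler metric with potential `φ` on `U` is invariant under the standard linear action of
`SU(n)`: each `A ∈ SU(n)` preserves `U` and pulls the Hermitian form
`(v, w) ↦ ∑ φ_{ij̄} v_i w̄_j` back to itself. -/
def IsSUInvariantOn (φ : (Fin n → ℂ) → ℝ) (U : Set (Fin n → ℂ)) : Prop :=
  ∀ A ∈ Matrix.specialUnitaryGroup (Fin n) ℂ, ∀ z ∈ U, A.mulVec z ∈ U ∧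
    A.transpose * complexHessian φ (A.mulVec z) * A.map (starRingEnd ℂ) = complexHessian φ z

/-! ### Symplectic potentials -/

/-- Partial derivative of a real function on `ℝⁿ`. -/
def pderiv (i : Fin n) (g : (Fin n → ℝ) → ℝ) (x : Fin n → ℝ) : ℝ :=
  fderiv ℝ g x (Pi.single i 1)

/-- A torus-invariant function on `ℂⁿ` in the logarithmic coordinates `a_j = Re (ln z_j)`. -/
def logForm (φ : (Fin n → ℂ) → ℝ) (a : Fin n → ℝ) : ℝ :=
  φ fun i => (Real.exp (a i) : ℂ)

/-- The set of all `a = Re (ln z)`, for `z` in a torus-invariant set `U` with all `z_j ≠ 0`. -/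
def logDomain (U : Set (Fin n → ℂ)) : Set (Fin n → ℝ) :=
  {a | (fun i => (Real.exp (a i) : ℂ)) ∈ U}

/-- The Legendre transform `a ↦ x = (∂φ/∂a_1, …, ∂φ/∂a_n)`, i.e. the moment map of the torus
action for `ω = 2i ∂∂̄φ` in the coordinates `a`. -/
def legendre (φ : (Fin n → ℂ) → ℝ) (a : Fin n → ℝ) (i : Fin n) : ℝ :=
  pderiv i (logForm φ) a

/-- `g`, on the open set `P` of `ℝⁿ`, is the symplectic potential (the Legendre dual) of the
torus-invariant Kähler potential `φ` on `U`: the Legendre transform `a ↦ dφ_a = x` is a bijection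
onto `P`, its inverse is `x ↦ dg_x = a`, and `φ(a) + g(x) = ∑ (∂φ/∂a_i) (∂g/∂x_i)`. -/
structure IsSymplecticPotential (φ : (Fin n → ℂ) → ℝ) (U : Set (Fin n → ℂ))
    (P : Set (Fin n → ℝ)) (g : (Fin n → ℝ) → ℝ) : Prop where
  torus_invariant : ∀ z ∈ U, ∀ w : Fin n → ℂ, (∀ i, ‖w i‖ = ‖z i‖) → w ∈ U ∧ φ w = φ z
  isOpen : IsOpen P
  smooth : ContDiffOn ℝ ∞ g P
  bijOn : Set.BijOn (legendre φ) (logDomain U) P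
  inverse : ∀ a ∈ logDomain U, ∀ i, pderiv i g (legendre φ a) = a i
  dual : ∀ a ∈ logDomain U,
    logForm φ a + g (legendre φ a) = ∑ i, legendre φ a i * pderiv i g (legendre φ a)

/-! ### The radial case -/

/-- A nonempty open interval, bounded or not, of positive real numbers. -/
def IsPosInterval (J : Set ℝ) : Prop :=
  IsOpen J ∧ J.OrdConnected ∧ J.Nonempty ∧ J ⊆ Set.Ioi 0

/-- The spherical shell `{z ∈ ℂⁿ : |z|² ∈ J}`; for `J = (0, ∞)` this is `ℂⁿ ∖ {0}`. -/
def shell (n : ℕ) (J : Set ℝ) : Set (Fin n → ℂ) := {z | ∑ i, ‖z i‖ ^ 2 ∈ J}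

/-- The function `z ↦ f(s)`, `s = |z|²`, on `ℂⁿ`. -/
def radial (n : ℕ) (f : ℝ → ℝ) (z : Fin n → ℂ) : ℝ := f (∑ i, ‖z i‖ ^ 2)

/-- `t = 2 s f'(s)`. -/
def tCoord (f : ℝ → ℝ) (s : ℝ) : ℝ := 2 * s * deriv f s

/-- The interval of all values of `t = 2 s f'(s)`, `s ∈ J`. -/
def tRange (f : ℝ → ℝ) (J : Set ℝ) : Set ℝ := tCoord f '' J

/-- `s(t)`, the inverse function of `s ↦ t = 2 s f'(s)` on `J`. -/
def sOf (f : ℝ → ℝ) (J : Set ℝ) : ℝ → ℝ := Function.invFunOn (tCoord f) J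

/-- `F(t) = t ln (s(t) / t) - 2 f(s(t))`. -/
def tPotential (f : ℝ → ℝ) (J : Set ℝ) (t : ℝ) : ℝ :=
  t * Real.log (sOf f J t / t) - 2 * f (sOf f J t)

/-- The part `{x : x_i > 0, ∑ x_i ∈ I}` of the open positive orthant. -/
def orthantPart (n : ℕ) (I : Set ℝ) : Set (Fin n → ℝ) := {x | (∀ i, 0 < x i) ∧ ∑ i, x i ∈ I}

/-- `g(x) = ½ (∑ x_i ln x_i + F(t))`, `t = ∑ x_i`. -/
def gPotential (n : ℕ) (F : ℝ → ℝ) (x : Fin n → ℝ) : ℝ :=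
  (1 / 2) * (∑ i, x i * Real.log (x i) + F (∑ i, x i))

end ToricKahler

end

/-!
Everything reduces to two functions of the single variable `s = |z|²`. The complex Hessian of
`f(|z|²)` is `f' + f'' z̄ zᵀ` (`complexHessian_radial`), a multiple of the identity plus a rank-one
Hermitian matrix. It has the eigenvalues `f'` on `z̄^⊥` and `f' + s f''` on `z̄`, so
it is positive definite as soon as `f' > 0` and `t = 2 s f'(s)` has positive derivative
(`IsRadialPotential`). Conversely, evaluation at `(√s, 0, …, 0)` shows that a Kähler potential
satisfies both conditions, the first one only for `n ≥ 2`. Unitary matrices preserve `|z|²`, hence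
the Hessian.

The Legendre transform of `f(|z|²)` is `x_i = (t / s) e^{2 a_i}`, with `∑ x_i = t`. Differentiating
`F(t) = t ln (s / t) - 2 f(s)` through the substitution `t = t(s)` (`hasDerivAt_of_comp_eq`) gives
`F'(t) = ln s - ln t - 1` and `F''(t) = 1 / (s dt/ds) - 1/t > -1/t`; the first of these says that
the gradient of `½ (∑ x_i ln x_i + F)` inverts the Legendre transform.

For the scalar curvature, `det H = (t / s)^{n-1} dt/ds` is again a function of `s`
(`logVolume`), so the Ricci form is minus a Hessian of the same shape and its trace is read off from
the eigenvalues. On the other side `t^{n+1} F'' / (1 + t F'') = t^n - t^{n-1} s dt/ds`, whose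
derivative in `t` is `-t^{n-1} s (ln det H)'`; differentiating once more gives `t^{n-1}` times the
trace.

In the converse direction, a given `F` determines `s = t e^{1 + F'(t)}` and
`2 f(s) = t (1 + F'(t)) - F(t)`, and `F'' > -1/t` is the condition `ds/dt > 0`. A symplectic
potential forces the same two formulas (`eq_of_isSymplecticPotential`), which is the uniqueness.
-/

noncomputable section

namespace ToricKahler

open Set Filter Topology

/-! ### Differentiation of radial functions -/

theorem isOpen_shell (n : ℕ) {J : Set ℝ} (hJ : IsOpen J) : IsOpen (shell n J) :=
  hJ.preimage (by fun_prop)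

theorem hasFDerivAt_sum_norm_sq {n : ℕ} (z : Fin n → ℂ) :
    HasFDerivAt (fun w : Fin n → ℂ => ∑ i, ‖w i‖ ^ 2)
      (∑ i, 2 • (innerSL ℝ (z i)).comp (ContinuousLinearMap.proj (R := ℝ) i)) z :=
  HasFDerivAt.fun_sum fun i _ => (hasFDerivAt_apply (𝕜 := ℝ) i z).norm_sq

/-- `d(g(|z|²) ψ) = g'(|z|²) ψ d|z|² + g(|z|²) dψ`, evaluated on the real tangent vector `c` in the
`k`-th coordinate, where `d|z|² = 2 Re (z_k c̄)`. -/
theorem fderiv_radial_mul {n : ℕ} {g : ℝ → ℝ} {ψ : (Fin n → ℂ) → ℂ} {z : Fin n → ℂ}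
    {ψ' : (Fin n → ℂ) →L[ℝ] ℂ} (hg : DifferentiableAt ℝ g (∑ i, ‖z i‖ ^ 2))
    (hψ : HasFDerivAt ψ ψ' z) (k : Fin n) (c : ℂ) :
    fderiv ℝ (fun w => (g (∑ i, ‖w i‖ ^ 2) : ℂ) * ψ w) z (Pi.single k c) =
      deriv g (∑ i, ‖z i‖ ^ 2) * ((2 * (z k * star c).re : ℝ) : ℂ) * ψ z +
        g (∑ i, ‖z i‖ ^ 2) * ψ' (Pi.single k c) := by
  have h0 := hasFDerivAt_sum_norm_sq z
  have hval : (∑ i, 2 • (innerSL ℝ (z i)).comp (ContinuousLinearMap.proj (R := ℝ) i))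
      (Pi.single k c : Fin n → ℂ) = 2 * (z k * star c).re := by
    rw [sum_apply, Finset.sum_eq_single k]
    · simp [Complex.inner]; ring
    · intro b _ hb; simp [hb]
    · simp
  generalize (∑ i, 2 • (innerSL ℝ (z i)).comp (ContinuousLinearMap.proj (R := ℝ) i)) = D
    at h0 hval
  have h1 : HasFDerivAt (fun w : Fin n → ℂ => g (∑ i, ‖w i‖ ^ 2)) _ z :=
    hg.hasDerivAt.comp_hasFDerivAt z h0
  have h2 : HasFDerivAt (fun w : Fin n → ℂ => (g (∑ i, ‖w i‖ ^ 2) : ℂ)) _ z :=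
    Complex.ofRealCLM.hasFDerivAt.comp z h1
  rw [(h2.fun_mul hψ).fderiv]
  simp [hval, -Complex.mul_re]
  ring

theorem dZbar_radial {n : ℕ} {f : ℝ → ℝ} {z : Fin n → ℂ}
    (hf : DifferentiableAt ℝ f (∑ i, ‖z i‖ ^ 2)) (j : Fin n) :
    dZbar j (fun u => (radial n f u : ℂ)) z = deriv f (∑ i, ‖z i‖ ^ 2) * z j := by
  have h := fderiv_radial_mul (z := z) hf (hasFDerivAt_const (1 : ℂ) z) j
  simp only [mul_one] at h
  simp only [dZbar, radial]
  rw [h, h]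
  apply Complex.ext <;> simp <;> ring

theorem dZ_radial_mul {n : ℕ} {g : ℝ → ℝ} {z : Fin n → ℂ}
    (hg : DifferentiableAt ℝ g (∑ i, ‖z i‖ ^ 2)) (i j : Fin n) :
    dZ i (fun w => (g (∑ i, ‖w i‖ ^ 2) : ℂ) * w j) z =
      g (∑ i, ‖z i‖ ^ 2) * (1 : Matrix (Fin n) (Fin n) ℂ) i j +
        deriv g (∑ i, ‖z i‖ ^ 2) * (star (z i) * z j) := by
  have h := fderiv_radial_mul (z := z) hg (hasFDerivAt_apply (𝕜 := ℝ) j z) i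
  simp only [dZ]
  rw [h, h]
  rcases eq_or_ne i j with rfl | hij
  · apply Complex.ext <;> simp <;> ring
  · apply Complex.ext <;> simp [hij, hij.symm] <;> ring

/-- The complex Hessian depends only on the germ of the function. -/
theorem complexHessian_congr {n : ℕ} {φ ψ : (Fin n → ℂ) → ℝ} {z : Fin n → ℂ}
    (h : φ =ᶠ[𝓝 z] ψ) : complexHessian φ z = complexHessian ψ z := by
  ext i j
  have : (fun w => dZbar j (fun u => (φ u : ℂ)) w) =ᶠ[𝓝 z]
      fun w => dZbar j (fun u => (ψ u : ℂ)) w := by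
    filter_upwards [h.eventuallyEq_nhds] with w hw
    have hw' : (fun u => (φ u : ℂ)) =ᶠ[𝓝 w] fun u => (ψ u : ℂ) :=
      hw.mono fun u hu => congrArg Complex.ofReal hu
    simp only [dZbar, hw'.fderiv_eq]
  simp only [complexHessian, Matrix.of_apply, dZ, this.fderiv_eq]

/-- The complex Hessian of `f(|z|²)` is `f' δ_{ij} + f'' z̄_i z_j`. -/
theorem complexHessian_radial {n : ℕ} {J : Set ℝ} {f : ℝ → ℝ} {z : Fin n → ℂ} (hJ : IsOpen J)
    (hf : ContDiffOn ℝ 2 f J) (hz : z ∈ shell n J) :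
    complexHessian (radial n f) z =
      ((deriv f (∑ i, ‖z i‖ ^ 2) : ℝ) : ℂ) • (1 : Matrix (Fin n) (Fin n) ℂ) +
        ((deriv (deriv f) (∑ i, ‖z i‖ ^ 2) : ℝ) : ℂ) • Matrix.vecMulVec (star z) z := by
  ext i j
  have h1 : (fun w => dZbar j (fun u => (radial n f u : ℂ)) w) =ᶠ[𝓝 z]
      fun w => ((deriv f (∑ i, ‖w i‖ ^ 2) : ℝ) : ℂ) * w j := by
    filter_upwards [(isOpen_shell n hJ).mem_nhds hz] with w hw
    exact dZbar_radial ((hf.differentiableOn (by norm_num)).differentiableAt (hJ.mem_nhds hw)) j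
  have h2 : DifferentiableAt ℝ (deriv f) (∑ i, ‖z i‖ ^ 2) :=
    ((hf.deriv_of_isOpen (m := 1) hJ (by norm_num)).differentiableOn (by norm_num)).differentiableAt
      (hJ.mem_nhds hz)
  have h3 := dZ_radial_mul h2 i j
  simp only [complexHessian, Matrix.of_apply]
  rw [dZ, h1.fderiv_eq, ← dZ, h3]
  simp [Matrix.vecMulVec_apply]

theorem contDiffOn_radial {n : ℕ} {J : Set ℝ} {f : ℝ → ℝ} {m : WithTop ℕ∞}
    (hf : ContDiffOn ℝ m f J) : ContDiffOn ℝ m (radial n f) (shell n J) :=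
  hf.comp (t := J) (s := shell n J) (f := fun z : Fin n → ℂ => ∑ i, ‖z i‖ ^ 2)
    (ContDiff.contDiffOn (ContDiff.sum fun i _ => (contDiff_apply ℝ ℂ i).norm_sq ℝ)) fun _ h => h

/-! ### Scalar matrices perturbed by a rank-one Hermitian matrix -/

open Matrix in
theorem dotProduct_star_self_eq {n : ℕ} (z : Fin n → ℂ) :
    z ⬝ᵥ star z = ((∑ i, ‖z i‖ ^ 2 : ℝ) : ℂ) := by
  simp [dotProduct, Complex.mul_conj, Complex.normSq_eq_norm_sq]

open Matrix in
theorem vecMulVec_star_mul_self {n : ℕ} (z : Fin n → ℂ) :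
    vecMulVec (star z) z * vecMulVec (star z) z =
      ((∑ i, ‖z i‖ ^ 2 : ℝ) : ℂ) • vecMulVec (star z) z := by
  rw [vecMulVec_mul_vecMulVec, dotProduct_star_self_eq, vecMulVec_smul]

open Matrix in
theorem det_smul_one_add_rankOne {n : ℕ} (hn : 1 ≤ n) {a b : ℂ} (ha : a ≠ 0) (z : Fin n → ℂ) :
    (a • (1 : Matrix (Fin n) (Fin n) ℂ) + b • vecMulVec (star z) z).det =
      a ^ (n - 1) * (a + ((∑ i, ‖z i‖ ^ 2 : ℝ) : ℂ) * b) := by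
  have h : a • (1 : Matrix (Fin n) (Fin n) ℂ) + b • vecMulVec (star z) z =
      a • (1 + vecMulVec ((b / a) • star z) z) := by
    rw [smul_add, smul_vecMulVec, smul_smul, mul_div_cancel₀ _ ha]
  obtain ⟨m, rfl⟩ : ∃ m, n = m + 1 := ⟨n - 1, by omega⟩
  rw [h, det_smul, vecMulVec_eq Unit, det_one_add_replicateCol_mul_replicateRow, dotProduct_smul,
    dotProduct_star_self_eq]
  simp only [Fintype.card_fin, Nat.add_sub_cancel, smul_eq_mul]
  field_simp
  ring

open Matrix in
/-- `a + b u uᴴ` has the eigenvalues `a` (on `u^⊥`) and `a + |u|² b` (on `u`). -/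
theorem trace_inv_mul_rankOne {n : ℕ} {a b a' b' : ℂ} (ha : a ≠ 0) (z : Fin n → ℂ)
    (hab : a + ((∑ i, ‖z i‖ ^ 2 : ℝ) : ℂ) * b ≠ 0) :
    ((a • (1 : Matrix (Fin n) (Fin n) ℂ) + b • vecMulVec (star z) z)⁻¹ *
      (a' • (1 : Matrix (Fin n) (Fin n) ℂ) + b' • vecMulVec (star z) z)).trace =
      (n - 1) * (a' / a) + (a' + ((∑ i, ‖z i‖ ^ 2 : ℝ) : ℂ) * b') /
        (a + ((∑ i, ‖z i‖ ^ 2 : ℝ) : ℂ) * b) := by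
  have hE := vecMulVec_star_mul_self z
  have htr : (vecMulVec (star z) z).trace = ((∑ i, ‖z i‖ ^ 2 : ℝ) : ℂ) := by
    rw [trace_vecMulVec, dotProduct_comm, dotProduct_star_self_eq]
  generalize ((∑ i, ‖z i‖ ^ 2 : ℝ) : ℂ) = s at *
  generalize vecMulVec (star z) z = E at *
  rw [mul_comm s b] at *
  have hinv : (a • (1 : Matrix (Fin n) (Fin n) ℂ) + b • E)⁻¹ =
      a⁻¹ • (1 : Matrix (Fin n) (Fin n) ℂ) - (b / (a * (a + b * s))) • E := by
    apply inv_eq_right_inv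
    simp only [add_mul, mul_sub, smul_mul_assoc, mul_smul_comm, one_mul, mul_one, smul_smul, hE]
    have haa : a⁻¹ * a = 1 := inv_mul_cancel₀ ha
    have : a * (b / (a * (a + b * s))) + b * (b / (a * (a + b * s))) * s = a⁻¹ * b := by
      field_simp
    linear_combination (norm := module) haa • (1 : Matrix (Fin n) (Fin n) ℂ) - this • E
  rw [hinv]
  simp only [sub_mul, mul_add, smul_mul_assoc, mul_smul_comm, one_mul, mul_one, smul_smul, hE,
    trace_sub, trace_add, trace_smul, trace_one, htr, smul_eq_mul, Fintype.card_fin]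
  have h : b / (a * (a + b * s)) * s = a⁻¹ - (a + b * s)⁻¹ := by
    field_simp
    ring
  linear_combination -(a' + b' * s) * h

open Matrix in
theorem isHermitian_smul_one_add_rankOne {n : ℕ} (a b : ℝ) (z : Fin n → ℂ) :
    ((a : ℂ) • (1 : Matrix (Fin n) (Fin n) ℂ) + (b : ℂ) • vecMulVec (star z) z).IsHermitian := by
  ext i j
  simp [vecMulVec_apply, Matrix.one_apply, eq_comm, mul_comm, apply_ite]

open Matrix in
theorem posDef_smul_one_add_rankOne {n : ℕ} {a b : ℝ} (z : Fin n → ℂ) (ha : 0 < a)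
    (hab : 0 < a + (∑ i, ‖z i‖ ^ 2) * b) :
    ((a : ℂ) • (1 : Matrix (Fin n) (Fin n) ℂ) + (b : ℂ) • vecMulVec (star z) z).PosDef := by
  refine PosDef.of_dotProduct_mulVec_pos (isHermitian_smul_one_add_rankOne a b z) fun v hv => ?_
  have hform : star v ⬝ᵥ (((a : ℂ) • (1 : Matrix (Fin n) (Fin n) ℂ) +
      (b : ℂ) • vecMulVec (star z) z) *ᵥ v) =
      ((a * ∑ i, ‖v i‖ ^ 2 + b * ‖z ⬝ᵥ v‖ ^ 2 : ℝ) : ℂ) := by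
    have h1 : star v ⬝ᵥ star z = star (z ⬝ᵥ v) := by rw [star_dotProduct_star, dotProduct_comm]
    rw [add_mulVec, smul_mulVec, smul_mulVec, one_mulVec, vecMulVec_mulVec, dotProduct_add,
      dotProduct_smul, dotProduct_smul, op_smul_eq_smul, dotProduct_smul, h1,
      dotProduct_comm (star v) v, dotProduct_star_self_eq]
    simp only [smul_eq_mul]
    rw [Complex.star_def, Complex.mul_conj, Complex.normSq_eq_norm_sq]
    push_cast
    rfl
  rw [hform, Complex.zero_lt_real]
  have hvpos : 0 < ∑ i, ‖v i‖ ^ 2 := by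
    obtain ⟨i, hi⟩ := Function.ne_iff.mp hv
    exact Finset.sum_pos' (fun _ _ => by positivity)
      ⟨i, Finset.mem_univ i, by have := norm_pos_iff.mpr hi; positivity⟩
  have hcs : ‖z ⬝ᵥ v‖ ^ 2 ≤ (∑ i, ‖z i‖ ^ 2) * ∑ i, ‖v i‖ ^ 2 := by
    have h1 : ‖z ⬝ᵥ v‖ ≤ ∑ i, ‖z i‖ * ‖v i‖ :=
      (norm_sum_le _ _).trans_eq (Finset.sum_congr rfl fun _ _ => norm_mul _ _)
    calc ‖z ⬝ᵥ v‖ ^ 2 ≤ (∑ i, ‖z i‖ * ‖v i‖) ^ 2 := by gcongr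
      _ ≤ _ := Finset.sum_mul_sq_le_sq_mul_sq _ _ _
  -- for `b < 0`, Cauchy-Schwarz bounds the form below by `(a + |z|² b) |v|²`
  rcases le_or_gt 0 b with hb | hb
  · positivity
  · nlinarith

open Matrix in
/-- Unitary matrices preserve `|z|²`. -/
theorem sum_norm_sq_mulVec {n : ℕ} {A : Matrix (Fin n) (Fin n) ℂ}
    (hA : A ∈ unitaryGroup (Fin n) ℂ) (z : Fin n → ℂ) :
    ∑ i, ‖(A *ᵥ z) i‖ ^ 2 = ∑ i, ‖z i‖ ^ 2 := by
  have h : star (A *ᵥ z) ⬝ᵥ (A *ᵥ z) = star z ⬝ᵥ z := by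
    rw [star_mulVec, dotProduct_mulVec, vecMul_vecMul, ← star_eq_conjTranspose,
      mem_unitaryGroup_iff'.mp hA, vecMul_one]
  rw [dotProduct_comm, dotProduct_star_self_eq, dotProduct_comm, dotProduct_star_self_eq] at h
  exact_mod_cast h

open Matrix in
theorem rankOne_pullback_unitary {n : ℕ} {A : Matrix (Fin n) (Fin n) ℂ}
    (hA : A ∈ unitaryGroup (Fin n) ℂ) (a b : ℂ) (z : Fin n → ℂ) :
    Aᵀ * (a • (1 : Matrix (Fin n) (Fin n) ℂ) + b • vecMulVec (star (A *ᵥ z)) (A *ᵥ z)) *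
      A.map (starRingEnd ℂ) = a • (1 : Matrix (Fin n) (Fin n) ℂ) + b • vecMulVec (star z) z := by
  have h1 : Aᵀ * A.map (starRingEnd ℂ) = 1 := by
    have := congrArg transpose (mem_unitaryGroup_iff'.mp hA)
    rw [transpose_mul, transpose_one] at this
    exact this
  have h2 : Aᵀ *ᵥ star (A *ᵥ z) = star z := by
    rw [star_mulVec, mulVec_transpose, vecMul_vecMul, ← star_eq_conjTranspose,
      mem_unitaryGroup_iff'.mp hA, vecMul_one]
  have h3 : (A *ᵥ z) ᵥ* A.map (starRingEnd ℂ) = z := by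
    rw [← vecMul_transpose, vecMul_vecMul, h1, vecMul_one]
  rw [mul_add, add_mul, mul_smul_comm, mul_smul_comm, mul_one, smul_mul_assoc, smul_mul_assoc, h1,
    mul_vecMulVec, vecMulVec_mul, h2, h3]

/-! ### Smooth changes of variable on an interval -/

theorem isOpen_image_of_injOn {g : ℝ → ℝ} {J : Set ℝ} (hJ : IsOpen J) (hc : ContinuousOn g J)
    (hi : InjOn g J) : IsOpen (g '' J) := by
  rw [isOpen_iff_mem_nhds]
  rintro _ ⟨s, hs, rfl⟩
  obtain ⟨ε, hε, hsub⟩ := Metric.isOpen_iff.mp hJ s hs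
  have hIcc : Icc (s - ε / 2) (s + ε / 2) ⊆ J := fun x hx => hsub <| by
    rw [Metric.mem_ball, Real.dist_eq, abs_lt]
    constructor <;> linarith [hx.1, hx.2]
  have hab : s - ε / 2 ≤ s + ε / 2 := by linarith
  have hsm : s ∈ Icc (s - ε / 2) (s + ε / 2) := ⟨by linarith, by linarith⟩
  rcases (hc.mono hIcc).strictMonoOn_of_injOn_Icc' hab (hi.mono hIcc) with h | h
  · exact mem_of_superset (Icc_mem_nhds (h (left_mem_Icc.mpr hab) hsm (by linarith))
      (h hsm (right_mem_Icc.mpr hab) (by linarith)))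
      ((intermediate_value_Icc hab (hc.mono hIcc)).trans (image_mono hIcc))
  · exact mem_of_superset (Icc_mem_nhds (h hsm (right_mem_Icc.mpr hab) (by linarith))
      (h (left_mem_Icc.mpr hab) hsm (by linarith)))
      ((intermediate_value_Icc' hab (hc.mono hIcc)).trans (image_mono hIcc))

theorem IsPosInterval.image {g : ℝ → ℝ} {J : Set ℝ} (hJ : IsPosInterval J)
    (hc : ContinuousOn g J) (hi : InjOn g J) (hpos : ∀ s ∈ J, 0 < g s) :
    IsPosInterval (g '' J) :=
  ⟨isOpen_image_of_injOn hJ.1 hc hi, (hJ.2.1.isPreconnected.image g hc).ordConnected,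
    hJ.2.2.1.image g, image_subset_iff.mpr hpos⟩

theorem injOn_of_deriv_pos {g : ℝ → ℝ} {J : Set ℝ} (hJ : J.OrdConnected) (hc : ContinuousOn g J)
    (hpos : ∀ s ∈ J, 0 < deriv g s) : InjOn g J :=
  (strictMonoOn_of_deriv_pos hJ.convex hc fun s hs => hpos s (interior_subset hs)).injOn

/-- Differentiation of a function `G` known through the substitution `t = T(s)`:
`dG/dt = (dK/ds) / (dT/ds)` if `G(T(s)) = K(s)`. -/
theorem hasDerivAt_of_comp_eq {T G K : ℝ → ℝ} {J : Set ℝ} {s k t' : ℝ} (hJ : IsOpen J)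
    (hT : HasStrictDerivAt T t' s) (ht' : t' ≠ 0) (hs : s ∈ J) (hGK : ∀ x ∈ J, G (T x) = K x)
    (hK : HasDerivAt K k s) : HasDerivAt G (k / t') (T s) := by
  have hL := (hT.to_localInverse ht').hasDerivAt
  have hLs : hT.localInverse T t' s ht' (T s) = s :=
    HasStrictFDerivAt.localInverse_apply_image _
  have hev : G =ᶠ[𝓝 (T s)] K ∘ hT.localInverse T t' s ht' := by
    have hmem : ∀ᶠ t in 𝓝 (T s), hT.localInverse T t' s ht' t ∈ J :=
      hL.continuousAt.eventually_mem (hLs.symm ▸ hJ.mem_nhds hs)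
    filter_upwards [hT.eventually_right_inverse ht', hmem] with t h1 h2
    rw [Function.comp_apply, ← hGK _ h2, h1]
  have hcomp : HasDerivAt (K ∘ hT.localInverse T t' s ht') (k * t'⁻¹) (T s) :=
    HasDerivAt.comp (T s) (hLs.symm ▸ hK) hL
  exact (hcomp.congr_of_eventuallyEq hev).congr_deriv (div_eq_mul_inv k t').symm

theorem contDiffOn_of_comp_eq {T G K : ℝ → ℝ} {J : Set ℝ} (hJ : IsOpen J)
    (hT : ContDiffOn ℝ ∞ T J) (ht' : ∀ s ∈ J, deriv T s ≠ 0) (hGK : ∀ x ∈ J, G (T x) = K x)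
    (hK : ContDiffOn ℝ ∞ K J) : ContDiffOn ℝ ∞ G (T '' J) := by
  rintro _ ⟨s, hs, rfl⟩
  have hTs : ContDiffAt ℝ ∞ T s := hT.contDiffAt (hJ.mem_nhds hs)
  have hd : HasStrictDerivAt T (deriv T s) s := hTs.hasStrictDerivAt (by simp)
  have hfd := (hd.hasStrictFDerivAt_equiv (ht' s hs)).hasFDerivAt
  have hL := hTs.to_localInverse hfd (by simp)
  have hLs := hTs.localInverse_apply_image hfd (by simp)
  have hright : ∀ᶠ t in 𝓝 (T s), T (hTs.localInverse hfd (by simp) t) = t :=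
    HasStrictFDerivAt.eventually_right_inverse _
  generalize hTs.localInverse hfd (by simp) = L at hL hLs hright
  have hev : G =ᶠ[𝓝 (T s)] K ∘ L := by
    have hmem : ∀ᶠ t in 𝓝 (T s), L t ∈ J :=
      hL.continuousAt.eventually_mem (hLs.symm ▸ hJ.mem_nhds hs)
    filter_upwards [hright, hmem] with t h1 h2
    rw [Function.comp_apply, ← hGK _ h2, h1]
  have hKs : ContDiffAt ℝ ∞ K (L (T s)) := hLs.symm ▸ hK.contDiffAt (hJ.mem_nhds hs)
  exact ((hKs.comp (T s) hL).congr_of_eventuallyEq hev).contDiffWithinAt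

/-! ### The variable `t = 2 s f'(s)` -/

theorem contDiffOn_deriv_infty {f : ℝ → ℝ} {J : Set ℝ} (hJ : IsOpen J)
    (hf : ContDiffOn ℝ ∞ f J) : ContDiffOn ℝ ∞ (deriv f) J :=
  hf.deriv_of_isOpen hJ (by simp)

theorem hasDerivAt_of_contDiffOn {f : ℝ → ℝ} {J : Set ℝ} {s : ℝ} (hJ : IsOpen J)
    (hf : ContDiffOn ℝ ∞ f J) (hs : s ∈ J) : HasDerivAt f (deriv f s) s :=
  ((hf.differentiableOn (by simp)).differentiableAt (hJ.mem_nhds hs)).hasDerivAt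

theorem hasStrictDerivAt_of_contDiffOn {f : ℝ → ℝ} {J : Set ℝ} {s : ℝ} (hJ : IsOpen J)
    (hf : ContDiffOn ℝ ∞ f J) (hs : s ∈ J) : HasStrictDerivAt f (deriv f s) s :=
  (hf.contDiffAt (hJ.mem_nhds hs)).hasStrictDerivAt (by simp)

theorem contDiffOn_tCoord {f : ℝ → ℝ} {J : Set ℝ} (hJ : IsOpen J) (hf : ContDiffOn ℝ ∞ f J) :
    ContDiffOn ℝ ∞ (tCoord f) J :=
  (contDiff_const.mul contDiff_id).contDiffOn.mul (contDiffOn_deriv_infty hJ hf)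

theorem deriv_tCoord {f : ℝ → ℝ} {J : Set ℝ} {s : ℝ} (hJ : IsOpen J) (hf : ContDiffOn ℝ ∞ f J)
    (hs : s ∈ J) : deriv (tCoord f) s = 2 * (deriv f s + s * deriv (deriv f) s) := by
  have h := ((hasDerivAt_id s).const_mul 2).mul
    (hasDerivAt_of_contDiffOn hJ (contDiffOn_deriv_infty hJ hf) hs)
  refine h.deriv.trans ?_
  simp
  ring

/-- The condition `f' > 0`, `(2 s f')' > 0`, under which `f(|z|²)` is a Kähler potential: these
are, up to a factor, the eigenvalues `f'` and `f' + s f''` of its complex Hessian. -/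
structure IsRadialPotential (f : ℝ → ℝ) (J : Set ℝ) : Prop where
  interval : IsPosInterval J
  smooth : ContDiffOn ℝ ∞ f J
  deriv_pos : ∀ s ∈ J, 0 < deriv f s
  deriv_tCoord_pos : ∀ s ∈ J, 0 < deriv (tCoord f) s

namespace IsRadialPotential

variable {f : ℝ → ℝ} {J : Set ℝ} {s : ℝ}

theorem pos (h : IsRadialPotential f J) (hs : s ∈ J) : 0 < s := h.interval.2.2.2 hs

theorem tCoord_pos (h : IsRadialPotential f J) (hs : s ∈ J) : 0 < tCoord f s :=
  mul_pos (mul_pos two_pos (h.pos hs)) (h.deriv_pos s hs)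

theorem smooth_tCoord (h : IsRadialPotential f J) : ContDiffOn ℝ ∞ (tCoord f) J :=
  contDiffOn_tCoord h.interval.1 h.smooth

theorem injOn_tCoord (h : IsRadialPotential f J) : InjOn (tCoord f) J :=
  injOn_of_deriv_pos h.interval.2.1 h.smooth_tCoord.continuousOn h.deriv_tCoord_pos

theorem isPosInterval_tRange (h : IsRadialPotential f J) : IsPosInterval (tRange f J) :=
  h.interval.image h.smooth_tCoord.continuousOn h.injOn_tCoord fun _ hs => h.tCoord_pos hs

theorem bijOn_tCoord (h : IsRadialPotential f J) : BijOn (tCoord f) J (tRange f J) :=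
  h.injOn_tCoord.bijOn_image

theorem sOf_tCoord (h : IsRadialPotential f J) (hs : s ∈ J) : sOf f J (tCoord f s) = s :=
  h.injOn_tCoord.leftInvOn_invFunOn hs

theorem contDiffOn_sOf (h : IsRadialPotential f J) : ContDiffOn ℝ ∞ (sOf f J) (tRange f J) :=
  contDiffOn_of_comp_eq h.interval.1 h.smooth_tCoord (fun s hs => (h.deriv_tCoord_pos s hs).ne')
    (fun _ hs => h.sOf_tCoord hs) contDiffOn_id

theorem tPotential_tCoord (h : IsRadialPotential f J) (hs : s ∈ J) :
    tPotential f J (tCoord f s) = tCoord f s * Real.log (s / tCoord f s) - 2 * f s := by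
  rw [tPotential, h.sOf_tCoord hs]

theorem contDiffOn_tPotential (h : IsRadialPotential f J) :
    ContDiffOn ℝ ∞ (tPotential f J) (tRange f J) :=
  contDiffOn_of_comp_eq h.interval.1 h.smooth_tCoord (fun s hs => (h.deriv_tCoord_pos s hs).ne')
    (fun _ hs => h.tPotential_tCoord hs)
    ((h.smooth_tCoord.mul ((contDiffOn_id.div h.smooth_tCoord
      fun _ hs => (h.tCoord_pos hs).ne').log fun _ hs =>
        (div_pos (h.pos hs) (h.tCoord_pos hs)).ne')).sub (contDiffOn_const.mul h.smooth))

theorem hasStrictDerivAt_tCoord (h : IsRadialPotential f J) (hs : s ∈ J) :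
    HasStrictDerivAt (tCoord f) (deriv (tCoord f) s) s :=
  hasStrictDerivAt_of_contDiffOn h.interval.1 h.smooth_tCoord hs

/-- Differentiating `F(t) = t ln (s / t) - 2 f(s)`: the terms with `ds/dt` cancel because
`t = 2 s f'(s)`, as for every Legendre transform. -/
theorem hasDerivAt_potential (h : IsRadialPotential f J) {F : ℝ → ℝ}
    (hF : ∀ x ∈ J, F (tCoord f x) = tCoord f x * Real.log (x / tCoord f x) - 2 * f x)
    (hs : s ∈ J) : HasDerivAt F (Real.log s - Real.log (tCoord f s) - 1) (tCoord f s) := by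
  have hT := h.hasStrictDerivAt_tCoord hs
  have hs0 := (h.pos hs).ne'
  have ht0 := (h.tCoord_pos hs).ne'
  have ht'0 := (h.deriv_tCoord_pos s hs).ne'
  have hK := (hT.hasDerivAt.mul (((hasDerivAt_id s).div hT.hasDerivAt ht0).log
    (div_pos (h.pos hs) (h.tCoord_pos hs)).ne')).sub
    ((hasDerivAt_of_contDiffOn h.interval.1 h.smooth hs).const_mul 2)
  refine (hasDerivAt_of_comp_eq h.interval.1 hT ht'0 hs hF hK).congr_deriv ?_
  have hf' : 2 * deriv f s = tCoord f s / s := by rw [tCoord]; field_simp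
  rw [hf', ← Real.log_div hs0 ht0]
  simp only [Pi.div_apply, id]
  field_simp
  ring

theorem iteratedDeriv_two_potential (h : IsRadialPotential f J) {F : ℝ → ℝ}
    (hF : ∀ x ∈ J, F (tCoord f x) = tCoord f x * Real.log (x / tCoord f x) - 2 * f x)
    (hs : s ∈ J) :
    iteratedDeriv 2 F (tCoord f s) = 1 / (s * deriv (tCoord f) s) - 1 / tCoord f s := by
  have hT := h.hasStrictDerivAt_tCoord hs
  have hs0 := (h.pos hs).ne'
  have ht0 := (h.tCoord_pos hs).ne'
  have ht'0 := (h.deriv_tCoord_pos s hs).ne'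
  rw [iteratedDeriv_succ, iteratedDeriv_one]
  have hK := ((Real.hasDerivAt_log hs0).sub (hT.hasDerivAt.log ht0)).sub_const 1
  rw [(hasDerivAt_of_comp_eq h.interval.1 hT ht'0 hs
    (fun x hx => (h.hasDerivAt_potential hF hx).deriv) hK).deriv]
  field_simp

end IsRadialPotential

/-! ### Radial Kähler potentials -/

namespace IsRadialPotential

variable {n : ℕ} {f : ℝ → ℝ} {J : Set ℝ}

theorem deriv_add_mul_pos (h : IsRadialPotential f J) {s : ℝ} (hs : s ∈ J) :
    0 < deriv f s + s * deriv (deriv f) s := by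
  have := h.deriv_tCoord_pos s hs
  rw [deriv_tCoord h.interval.1 h.smooth hs] at this
  linarith

theorem isKahlerPotentialOn (h : IsRadialPotential f J) :
    IsKahlerPotentialOn (radial n f) (shell n J) := by
  refine ⟨contDiffOn_radial h.smooth, fun z hz => ?_⟩
  rw [complexHessian_radial h.interval.1 (h.smooth.of_le (by norm_cast)) hz]
  exact posDef_smul_one_add_rankOne z (h.deriv_pos _ hz) (h.deriv_add_mul_pos hz)

theorem isSUInvariantOn (h : IsRadialPotential f J) :
    IsSUInvariantOn (radial n f) (shell n J) := by
  intro A hA z hz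
  have hU := (Matrix.mem_specialUnitaryGroup_iff.mp hA).1
  have hnorm := sum_norm_sq_mulVec hU z
  have hAz : A.mulVec z ∈ shell n J := by
    change ∑ i, ‖(A.mulVec z) i‖ ^ 2 ∈ J
    rwa [hnorm]
  have hf2 : ContDiffOn ℝ 2 f J := h.smooth.of_le (by norm_cast)
  refine ⟨hAz, ?_⟩
  rw [complexHessian_radial h.interval.1 hf2 hAz, complexHessian_radial h.interval.1 hf2 hz, hnorm,
    rankOne_pullback_unitary hU]

end IsRadialPotential

/-- At the points `(√s, 0, …, 0)` the complex Hessian is the diagonal matrix with entries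
`f' + s f''`, `f'`, …, `f'`; the entry `f'` is absent for `n = 1`, whence the hypothesis `h1`. -/
theorem IsKahlerPotentialOn.isRadialPotential {n : ℕ} {f : ℝ → ℝ} {J : Set ℝ} (hn : 1 ≤ n)
    (hJ : IsPosInterval J) (hf : ContDiffOn ℝ ∞ f J)
    (hK : IsKahlerPotentialOn (radial n f) (shell n J)) (h1 : n = 1 → ∀ s ∈ J, 0 < deriv f s) :
    IsRadialPotential f J := by
  have key : ∀ s ∈ J, 0 < deriv f s + s * deriv (deriv f) s ∧
      (n ≠ 1 → 0 < deriv f s) := by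
    intro s hs
    have hs0 : 0 < s := hJ.2.2.2 hs
    let i₀ : Fin n := ⟨0, hn⟩
    let z : Fin n → ℂ := Pi.single i₀ ((Real.sqrt s : ℝ) : ℂ)
    have hz : ∑ i, ‖z i‖ ^ 2 = s := by
      rw [Finset.sum_eq_single i₀ (fun b _ hb => by simp [z, hb]) (by simp)]
      simp [z, Real.sq_sqrt hs0.le]
    have hzJ : z ∈ shell n J := by
      change ∑ i, ‖z i‖ ^ 2 ∈ J
      rwa [hz]
    have hpos := hK.2 z hzJ
    rw [complexHessian_radial hJ.1 (hf.of_le (by norm_cast)) hzJ, hz] at hpos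
    constructor
    · have h := hpos.diag_pos (i := i₀)
      simp only [Matrix.add_apply, Matrix.smul_apply, Matrix.one_apply_eq, Matrix.vecMulVec_apply,
        smul_eq_mul, mul_one, z, Pi.star_apply, Pi.single_eq_same, Complex.star_def,
        Complex.conj_ofReal] at h
      rw [← Complex.ofReal_mul, Real.mul_self_sqrt hs0.le, ← Complex.ofReal_mul,
        ← Complex.ofReal_add, Complex.zero_lt_real] at h
      linarith
    · intro hn1
      have h := hpos.diag_pos (i := (⟨1, by omega⟩ : Fin n))
      simpa [Matrix.vecMulVec_apply, z, i₀] using h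
  refine ⟨hJ, hf, fun s hs => ?_, fun s hs => ?_⟩
  · by_cases hn1 : n = 1
    · exact h1 hn1 s hs
    · exact (key s hs).2 hn1
  · rw [deriv_tCoord hJ.1 hf hs]
    linarith [(key s hs).1]

/-! ### The scalar curvature -/

/-- `ln det H` as a function of `s = |z|²`, where `H` is the matrix of the Kähler form `2i ∂∂̄f`:
its eigenvalues are `2 f' = t / s`, with multiplicity `n - 1`, and `2 (f' + s f'') = dt/ds`. -/
def logVolume (n : ℕ) (f : ℝ → ℝ) (s : ℝ) : ℝ :=
  Real.log ((tCoord f s / s) ^ (n - 1) * deriv (tCoord f) s)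

namespace IsRadialPotential

variable {n : ℕ} {f : ℝ → ℝ} {J : Set ℝ} {s : ℝ}

theorem log_det_kahlerMatrix (hn : 1 ≤ n) (h : IsRadialPotential f J) {z : Fin n → ℂ}
    (hz : z ∈ shell n J) :
    Real.log (kahlerMatrix (radial n f) z).det.re = radial n (logVolume n f) z := by
  have hs : ∑ i, ‖z i‖ ^ 2 ∈ J := hz
  have hs0 := (h.pos hs).ne'
  have ha : ((deriv f (∑ i, ‖z i‖ ^ 2) : ℝ) : ℂ) ≠ 0 := by
    exact_mod_cast (h.deriv_pos _ hs).ne'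
  rw [kahlerMatrix, complexHessian_radial h.interval.1
    (h.smooth.of_le (by norm_cast)) hz, Matrix.det_smul,
    det_smul_one_add_rankOne hn ha, radial, logVolume, deriv_tCoord h.interval.1 h.smooth hs,
    tCoord]
  obtain ⟨m, rfl⟩ : ∃ m, n = m + 1 := ⟨n - 1, by omega⟩
  generalize ∑ i, ‖z i‖ ^ 2 = s at *
  congr 1
  rw [Fintype.card_fin, Nat.add_sub_cancel, mul_right_comm 2 s, mul_div_cancel_right₀ _ hs0,
    mul_pow, ← Complex.ofReal_pow, ← Complex.ofReal_mul, ← Complex.ofReal_add,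
    ← Complex.ofReal_mul, ← Complex.ofReal_ofNat, ← Complex.ofReal_pow, ← Complex.ofReal_mul,
    Complex.ofReal_re]
  ring

theorem contDiffOn_logVolume (h : IsRadialPotential f J) :
    ContDiffOn ℝ ∞ (logVolume n f) J :=
  (((h.smooth_tCoord.div contDiffOn_id fun _ hs => (h.pos hs).ne').pow (n - 1)).mul
    (contDiffOn_deriv_infty h.interval.1 h.smooth_tCoord)).log fun s hs =>
      (mul_pos (pow_pos (div_pos (h.tCoord_pos hs) (h.pos hs)) _) (h.deriv_tCoord_pos s hs)).ne'

theorem deriv_logVolume (hn : 1 ≤ n) (h : IsRadialPotential f J) (hs : s ∈ J) :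
    deriv (logVolume n f) s = (n - 1) * (deriv (tCoord f) s / tCoord f s - 1 / s) +
      deriv (deriv (tCoord f)) s / deriv (tCoord f) s := by
  have hs0 := (h.pos hs).ne'
  have ht0 := (h.tCoord_pos hs).ne'
  have ht'0 := (h.deriv_tCoord_pos s hs).ne'
  have hev : logVolume n f =ᶠ[𝓝 s] fun x => (n - 1) * (Real.log (tCoord f x) - Real.log x) +
      Real.log (deriv (tCoord f) x) := by
    filter_upwards [h.interval.1.mem_nhds hs] with x hx
    have hx0 := (h.pos hx).ne'
    have htx0 := (h.tCoord_pos hx).ne'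
    rw [logVolume, Real.log_mul (pow_ne_zero _ (div_ne_zero htx0 hx0))
      (h.deriv_tCoord_pos x hx).ne', Real.log_pow, Real.log_div htx0 hx0, Nat.cast_sub hn,
      Nat.cast_one]
  rw [hev.deriv_eq]
  have hT := (h.hasStrictDerivAt_tCoord hs).hasDerivAt
  have hT' := hasDerivAt_of_contDiffOn h.interval.1
    (contDiffOn_deriv_infty h.interval.1 h.smooth_tCoord) hs
  have hd := (((hT.log ht0).fun_sub (Real.hasDerivAt_log hs0)).const_mul ((n : ℝ) - 1)).fun_add
    (hT'.log ht'0)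
  rw [hd.deriv, one_div]

theorem scalarCurvature_radial (hn : 1 ≤ n) (h : IsRadialPotential f J) {z : Fin n → ℂ}
    (hz : z ∈ shell n J) (hs : ∑ i, ‖z i‖ ^ 2 = s) :
    scalarCurvature (radial n f) z =
      ((-((n - 1) * (s * deriv (logVolume n f) s / tCoord f s) +
        (deriv (logVolume n f) s + s * deriv (deriv (logVolume n f)) s) /
          deriv (tCoord f) s) : ℝ) : ℂ) := by
  have hsJ : s ∈ J := hs ▸ hz
  have hs0 := (h.pos hsJ).ne'
  have ha := (h.deriv_pos s hsJ).ne'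
  have hab := (h.deriv_add_mul_pos hsJ).ne'
  have hev : (fun w => Real.log (kahlerMatrix (radial n f) w).det.re) =ᶠ[𝓝 z]
      radial n (logVolume n f) := by
    filter_upwards [(isOpen_shell n h.interval.1).mem_nhds hz] with w hw
    exact h.log_det_kahlerMatrix hn hw
  have hle : (2 : WithTop ℕ∞) ≤ ∞ := by norm_cast
  rw [scalarCurvature, ricciMatrix, complexHessian_congr hev, kahlerMatrix,
    complexHessian_radial h.interval.1 (h.contDiffOn_logVolume.of_le hle) hz,
    complexHessian_radial h.interval.1 (h.smooth.of_le hle) hz, smul_add, smul_smul, smul_smul,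
    mul_neg, Matrix.trace_neg, trace_inv_mul_rankOne, hs, deriv_tCoord h.interval.1 h.smooth hsJ,
    tCoord]
  · generalize deriv f s = a at *
    generalize deriv (deriv f) s = b at *
    push_cast
    have ha' : (a : ℂ) ≠ 0 := by exact_mod_cast ha
    have hs' : (s : ℂ) ≠ 0 := by exact_mod_cast hs0
    have e : (2 : ℂ) * a + s * (2 * b) = 2 * (a + s * b) := by ring
    rw [e]
    congr 2
    field_simp
  · rw [hs]
    exact mul_ne_zero two_ne_zero (by exact_mod_cast ha)
  · rw [hs]
    have : (2 : ℂ) * (deriv f s : ℝ) + s * (2 * (deriv (deriv f) s : ℝ)) =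
        ((2 * (deriv f s + s * deriv (deriv f) s) : ℝ) : ℂ) := by push_cast; ring
    rw [this]
    exact_mod_cast mul_ne_zero two_ne_zero hab

/-- With `G(t) = t^{n+1} F'' / (1 + t F'')` one has `dG/dt = -t^{n-1} s d(ln det H)/ds`, and a
second differentiation gives `t^{n-1}` times the trace of the Ricci form. -/
theorem scalarCurvature_eq (hn : 1 ≤ n) (h : IsRadialPotential f J) {z : Fin n → ℂ}
    (hz : z ∈ shell n J) {t : ℝ} (ht : t = tCoord f (∑ i, ‖z i‖ ^ 2)) :
    scalarCurvature (radial n f) z =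
      ((t ^ (1 - (n : ℤ)) * iteratedDeriv 2 (fun τ : ℝ => τ ^ (n + 1) *
        iteratedDeriv 2 (tPotential f J) τ /
          (1 + τ * iteratedDeriv 2 (tPotential f J) τ)) t : ℝ) : ℂ) := by
  obtain ⟨s, hs⟩ : ∃ s, ∑ i, ‖z i‖ ^ 2 = s := ⟨_, rfl⟩
  rw [hs] at ht
  subst ht
  have hsJ : s ∈ J := hs ▸ hz
  rw [h.scalarCurvature_radial hn hz hs]
  congr 1
  obtain ⟨m, rfl⟩ : ∃ m, n = m + 1 := ⟨n - 1, by omega⟩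
  have hJ := h.interval.1
  set G : ℝ → ℝ := fun τ => τ ^ (m + 1 + 1) * iteratedDeriv 2 (tPotential f J) τ /
    (1 + τ * iteratedDeriv 2 (tPotential f J) τ) with hG
  have hG0 : ∀ x ∈ J, G (tCoord f x) =
      tCoord f x ^ (m + 1) - tCoord f x ^ m * (x * deriv (tCoord f) x) := by
    intro x hx
    have hx0 := (h.pos hx).ne'
    have ht0 := (h.tCoord_pos hx).ne'
    have ht'0 := (h.deriv_tCoord_pos x hx).ne'
    simp only [hG, h.iteratedDeriv_two_potential (fun y hy => h.tPotential_tCoord hy) hx]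
    have e : 1 + tCoord f x * (1 / (x * deriv (tCoord f) x) - 1 / tCoord f x) =
        tCoord f x / (x * deriv (tCoord f) x) := by field_simp; ring
    rw [e]
    field_simp
    ring
  have hG1 : ∀ x ∈ J, deriv G (tCoord f x) =
      -(tCoord f x ^ m * (x * deriv (logVolume (m + 1) f) x)) := by
    intro x hx
    have hx0 := (h.pos hx).ne'
    have ht0 := (h.tCoord_pos hx).ne'
    have ht'0 := (h.deriv_tCoord_pos x hx).ne'
    have hT := h.hasStrictDerivAt_tCoord hx
    have hT' := hasDerivAt_of_contDiffOn hJ (contDiffOn_deriv_infty hJ h.smooth_tCoord) hx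
    have hK := (hT.hasDerivAt.pow (m + 1)).sub
      ((hT.hasDerivAt.pow m).mul ((hasDerivAt_id x).mul hT'))
    rw [(hasDerivAt_of_comp_eq hJ hT ht'0 hx hG0 hK).deriv, h.deriv_logVolume hn hx]
    simp only [Pi.mul_apply, Pi.pow_apply, id]
    rcases m with _ | m
    · simp
      field_simp
    · push_cast
      field_simp
      ring
  have hs0 := (h.pos hsJ).ne'
  have ht0 := (h.tCoord_pos hsJ).ne'
  have ht'0 := (h.deriv_tCoord_pos s hsJ).ne'
  have hT := h.hasStrictDerivAt_tCoord hsJ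
  have hL' := hasDerivAt_of_contDiffOn hJ
    (contDiffOn_deriv_infty hJ (h.contDiffOn_logVolume (n := m + 1))) hsJ
  have hK := ((hT.hasDerivAt.pow m).mul ((hasDerivAt_id s).mul hL')).neg
  rw [iteratedDeriv_succ, iteratedDeriv_one, (hasDerivAt_of_comp_eq hJ hT ht'0 hsJ hG1 hK).deriv]
  have e : tCoord f s ^ (1 - ((m + 1 : ℕ) : ℤ)) = (tCoord f s ^ m)⁻¹ := by
    rw [← zpow_natCast, ← zpow_neg]
    congr 1
    push_cast
    ring
  rw [e]
  simp only [Pi.mul_apply, Pi.pow_apply, id]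
  rcases m with _ | m
  · simp
    field_simp
    ring
  · push_cast
    field_simp
    ring

end IsRadialPotential

/-! ### Symplectic potentials of radial functions -/

variable {n : ℕ} {f F : ℝ → ℝ} {I J : Set ℝ}

theorem sum_norm_exp_sq (a : Fin n → ℝ) :
    ∑ i, ‖(Real.exp (a i) : ℂ)‖ ^ 2 = ∑ i, Real.exp (2 * a i) := by
  refine Finset.sum_congr rfl fun i _ => ?_
  rw [Complex.norm_real, Real.norm_of_nonneg (Real.exp_pos _).le, ← Real.exp_nat_mul,
    Nat.cast_ofNat]

theorem mem_logDomain_shell {a : Fin n → ℝ} :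
    a ∈ logDomain (shell n J) ↔ ∑ i, Real.exp (2 * a i) ∈ J := by
  rw [← sum_norm_exp_sq]
  rfl

theorem logForm_radial (a : Fin n → ℝ) :
    logForm (radial n f) a = f (∑ i, Real.exp (2 * a i)) := by
  rw [logForm, radial, sum_norm_exp_sq]

theorem legendre_radial {a : Fin n → ℝ}
    (hf : DifferentiableAt ℝ f (∑ i, Real.exp (2 * a i))) (i : Fin n) :
    legendre (radial n f) a i =
      2 * deriv f (∑ i, Real.exp (2 * a i)) * Real.exp (2 * a i) := by
  have h1 : HasFDerivAt (fun b : Fin n → ℝ => ∑ k, Real.exp (2 * b k)) _ a :=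
    HasFDerivAt.fun_sum fun k _ => ((hasFDerivAt_apply (𝕜 := ℝ) k a).const_mul 2).exp
  have h2 : HasFDerivAt (logForm (radial n f)) _ a :=
    (hf.hasDerivAt.comp_hasFDerivAt a h1).congr_of_eventuallyEq
      (Eventually.of_forall logForm_radial)
  have hval : (∑ k, Real.exp (2 * a k) • (2 : ℝ) • ContinuousLinearMap.proj (R := ℝ) k :
      (Fin n → ℝ) →L[ℝ] ℝ) (Pi.single i 1) = 2 * Real.exp (2 * a i) := by
    rw [sum_apply, Finset.sum_eq_single i]
    · simp
      ring
    · intro k _ hk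
      simp [hk]
    · simp
  rw [legendre, pderiv, h2.fderiv, smul_apply, hval, smul_eq_mul]
  ring

theorem sum_legendre_radial {a : Fin n → ℝ}
    (hf : DifferentiableAt ℝ f (∑ i, Real.exp (2 * a i))) :
    ∑ i, legendre (radial n f) a i = tCoord f (∑ i, Real.exp (2 * a i)) := by
  simp only [legendre_radial hf, ← Finset.mul_sum, tCoord]
  ring

theorem pderiv_gPotential {x : Fin n → ℝ} (hx : ∀ i, 0 < x i)
    (hF : DifferentiableAt ℝ F (∑ i, x i)) (i : Fin n) :
    pderiv i (gPotential n F) x = (1 / 2) * (Real.log (x i) + 1 + deriv F (∑ i, x i)) := by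
  have h1 : HasFDerivAt (fun y : Fin n → ℝ => ∑ k, y k * Real.log (y k)) _ x :=
    HasFDerivAt.fun_sum fun k _ =>
      HasDerivAt.comp_hasFDerivAt (h₂ := fun r : ℝ => r * Real.log r) x
        (Real.hasDerivAt_mul_log (hx k).ne') (hasFDerivAt_apply (𝕜 := ℝ) k x)
  have h2 : HasFDerivAt (fun y : Fin n → ℝ => F (∑ k, y k)) _ x :=
    hF.hasDerivAt.comp_hasFDerivAt x
      (HasFDerivAt.fun_sum fun k _ => hasFDerivAt_apply (𝕜 := ℝ) k x)
  have h3 : HasFDerivAt (gPotential n F) _ x := (h1.fun_add h2).const_mul (1 / 2)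
  have hval1 : (∑ k, (Real.log (x k) + 1) • ContinuousLinearMap.proj (R := ℝ) k :
      (Fin n → ℝ) →L[ℝ] ℝ) (Pi.single i 1) = Real.log (x i) + 1 := by
    rw [sum_apply, Finset.sum_eq_single i (fun k _ hk => by simp [hk]) (by simp)]
    simp
  have hval2 : (∑ k, ContinuousLinearMap.proj (R := ℝ) k : (Fin n → ℝ) →L[ℝ] ℝ)
      (Pi.single i 1) = 1 := by
    rw [sum_apply, Finset.sum_eq_single i (fun k _ hk => by simp [hk]) (by simp)]
    simp
  rw [pderiv, h3.fderiv, smul_apply, add_apply, smul_apply, hval1, hval2, smul_eq_mul, smul_eq_mul,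
    mul_one]

theorem isOpen_orthantPart (hI : IsOpen I) : IsOpen (orthantPart n I) := by
  have h : orthantPart n I =
      (⋂ i, {x : Fin n → ℝ | 0 < x i}) ∩ (fun x : Fin n → ℝ => ∑ i, x i) ⁻¹' I := by
    ext x
    simp [orthantPart]
  rw [h]
  exact (isOpen_iInter_of_finite fun i => isOpen_lt continuous_const (continuous_apply i)).inter
    (hI.preimage (by fun_prop))

theorem contDiffOn_gPotential (hF : ContDiffOn ℝ ∞ F I) :
    ContDiffOn ℝ ∞ (gPotential n F) (orthantPart n I) := by
  refine contDiffOn_const.mul (ContDiffOn.add (ContDiffOn.sum fun i _ => ?_) ?_)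
  · exact (contDiff_apply ℝ ℝ i).contDiffOn.mul
      ((contDiff_apply ℝ ℝ i).contDiffOn.log fun x hx => (hx.1 i).ne')
  · exact hF.comp (t := I) (f := fun x : Fin n → ℝ => ∑ i, x i)
      (ContDiff.contDiffOn (ContDiff.sum fun i _ => contDiff_apply ℝ ℝ i)) fun x hx => hx.2

theorem exp_two_mul_half_log {y : ℝ} (hy : 0 < y) : Real.exp (2 * (1 / 2 * Real.log y)) = y := by
  rw [← mul_assoc, mul_one_div_cancel two_ne_zero, one_mul, Real.exp_log hy]

namespace IsRadialPotential

/-- The Legendre transform of `f(|z|²)` is `x_i = (t / s) e^{2 a_i}`, with inverse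
`a_i = ½ ln (x_i s / t)`; since `F'(t) = ln (s / t) - 1`, this is `∂g/∂x_i`. -/
theorem isSymplecticPotential (h : IsRadialPotential f J)
    (hF : ∀ x ∈ J, F (tCoord f x) = tCoord f x * Real.log (x / tCoord f x) - 2 * f x)
    (hFsmooth : ContDiffOn ℝ ∞ F (tRange f J)) :
    IsSymplecticPotential (radial n f) (shell n J) (orthantPart n (tRange f J))
      (gPotential n F) := by
  have hdiff : ∀ s ∈ J, DifferentiableAt ℝ f s := fun s hs =>
    (hasDerivAt_of_contDiffOn h.interval.1 h.smooth hs).differentiableAt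
  have hleg : ∀ a ∈ logDomain (shell n J), ∀ i, legendre (radial n f) a i =
      tCoord f (∑ i, Real.exp (2 * a i)) / (∑ i, Real.exp (2 * a i)) * Real.exp (2 * a i) := by
    intro a ha i
    have hs := mem_logDomain_shell.mp ha
    have hs0 := (h.pos hs).ne'
    rw [legendre_radial (hdiff _ hs), tCoord]
    field_simp
  have hlegpos : ∀ a ∈ logDomain (shell n J), ∀ i, 0 < legendre (radial n f) a i := by
    intro a ha i
    have hs := mem_logDomain_shell.mp ha
    rw [hleg a ha]
    exact mul_pos (div_pos (h.tCoord_pos hs) (h.pos hs)) (Real.exp_pos _)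
  have hsum : ∀ a ∈ logDomain (shell n J), ∑ i, legendre (radial n f) a i =
      tCoord f (∑ i, Real.exp (2 * a i)) := fun a ha =>
    sum_legendre_radial (hdiff _ (mem_logDomain_shell.mp ha))
  have hlog : ∀ a ∈ logDomain (shell n J), ∀ i, Real.log (legendre (radial n f) a i) =
      Real.log (tCoord f (∑ i, Real.exp (2 * a i))) - Real.log (∑ i, Real.exp (2 * a i)) +
        2 * a i := by
    intro a ha i
    have hs := mem_logDomain_shell.mp ha
    rw [hleg a ha, Real.log_mul (div_pos (h.tCoord_pos hs) (h.pos hs)).ne' (Real.exp_pos _).ne',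
      Real.log_exp, Real.log_div (h.tCoord_pos hs).ne' (h.pos hs).ne']
  have hinv : ∀ a ∈ logDomain (shell n J), ∀ i,
      pderiv i (gPotential n F) (legendre (radial n f) a) = a i := by
    intro a ha i
    have hs := mem_logDomain_shell.mp ha
    have hFd := h.hasDerivAt_potential hF hs
    rw [← hsum a ha] at hFd
    rw [pderiv_gPotential (hlegpos a ha) hFd.differentiableAt, hFd.deriv, hlog a ha, hsum a ha]
    ring
  refine ⟨?_, isOpen_orthantPart h.isPosInterval_tRange.1, contDiffOn_gPotential hFsmooth,
    ⟨?_, ?_, ?_⟩, hinv, ?_⟩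
  · intro z hz w hw
    have hzw : ∑ i, ‖w i‖ ^ 2 = ∑ i, ‖z i‖ ^ 2 :=
      Finset.sum_congr rfl fun i _ => by rw [hw i]
    exact ⟨show ∑ i, ‖w i‖ ^ 2 ∈ J from hzw ▸ hz, congrArg f hzw⟩
  · intro a ha
    exact ⟨hlegpos a ha, by rw [hsum a ha]; exact mem_image_of_mem _ (mem_logDomain_shell.mp ha)⟩
  · intro a ha b hb hab
    ext i
    rw [← hinv a ha i, ← hinv b hb i, hab]
  · rintro x ⟨hx, s, hs, hst⟩
    have hs0 := h.pos hs
    have ht0 := h.tCoord_pos hs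
    let a : Fin n → ℝ := fun i => 1 / 2 * Real.log (x i * (s / tCoord f s))
    have hexp : ∀ i, Real.exp (2 * a i) = x i * (s / tCoord f s) := fun i =>
      exp_two_mul_half_log (mul_pos (hx i) (div_pos hs0 ht0))
    have hsa : ∑ i, Real.exp (2 * a i) = s := by
      simp only [hexp, ← Finset.sum_mul, ← hst]
      field_simp
    have ha : a ∈ logDomain (shell n J) := mem_logDomain_shell.mpr (hsa.symm ▸ hs)
    refine ⟨a, ha, ?_⟩
    ext i
    rw [hleg a ha, hsa, hexp]
    field_simp
  · intro a ha
    have hs := mem_logDomain_shell.mp ha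
    simp only [hinv a ha]
    rw [logForm_radial, gPotential, hsum a ha, hF _ hs,
      Real.log_div (h.pos hs).ne' (h.tCoord_pos hs).ne']
    simp only [hlog a ha, mul_add, Finset.sum_add_distrib, ← Finset.sum_mul, hsum a ha]
    have e : ∑ i, legendre (radial n f) a i * (2 * a i) =
        2 * ∑ i, legendre (radial n f) a i * a i := by
      rw [Finset.mul_sum]
      exact Finset.sum_congr rfl fun i _ => by ring
    rw [e]
    ring

end IsRadialPotential

/-- The symplectic potential `g` recovers both the variable `s` and the potential `f` as functions
of `t`: at the points of the moment image with `∑ x_i = t`, the relation `a = dg_x` gives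
`s = t e^{1 + F'(t)}`, and the duality of `f` and `g` gives `f(s)`. -/
theorem eq_of_isSymplecticPotential (hJ : IsPosInterval J) (hI : IsOpen I)
    (hf : ContDiffOn ℝ ∞ f J) (hF : ContDiffOn ℝ ∞ F I)
    (hg : IsSymplecticPotential (radial n f) (shell n J) (orthantPart n I) (gPotential n F))
    {a : Fin n → ℝ} (ha : a ∈ logDomain (shell n J)) {s t : ℝ}
    (hs : ∑ i, Real.exp (2 * a i) = s) (ht : ∑ i, legendre (radial n f) a i = t) :
    t ∈ I ∧ s = t * Real.exp (1 + deriv F t) ∧ 2 * f s = t * (1 + deriv F t) - F t := by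
  obtain ⟨hpos, htI⟩ := hg.bijOn.mapsTo ha
  rw [ht] at htI
  have hsJ : s ∈ J := hs ▸ mem_logDomain_shell.mp ha
  have hs0 : 0 < s := hJ.2.2.2 hsJ
  have hfd := (hasDerivAt_of_contDiffOn hJ.1 hf hsJ).differentiableAt
  have hFd := (hasDerivAt_of_contDiffOn hI hF htI).differentiableAt
  have hleg : ∀ i, legendre (radial n f) a i = t / s * Real.exp (2 * a i) := by
    intro i
    have := sum_legendre_radial (n := n) (f := f) (a := a) (hs.symm ▸ hfd)
    rw [ht, hs, tCoord] at this
    rw [legendre_radial (hs.symm ▸ hfd), hs, this]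
    field_simp
  have hlog : ∀ i, Real.log (legendre (radial n f) a i) = 2 * a i - 1 - deriv F t := by
    intro i
    have := hg.inverse a ha i
    rw [pderiv_gPotential hpos (ht.symm ▸ hFd), ht] at this
    linarith
  have hne : Nonempty (Fin n) := by
    by_contra hcon
    rw [not_nonempty_iff] at hcon
    simp at hs
    exact hs0.ne hs
  obtain ⟨i₀⟩ := hne
  have ht0 : 0 < t := ht ▸ Finset.sum_pos (fun i _ => hpos i) ⟨i₀, Finset.mem_univ _⟩
  refine ⟨htI, ?_, ?_⟩
  · have h1 := hlog i₀
    rw [hleg, Real.log_mul (div_pos ht0 hs0).ne' (Real.exp_pos _).ne', Real.log_exp,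
      Real.log_div ht0.ne' hs0.ne'] at h1
    rw [← Real.exp_log hs0, show Real.log s = Real.log t + (1 + deriv F t) by linarith,
      Real.exp_add, Real.exp_log ht0]
  · have h1 := hg.dual a ha
    rw [logForm_radial, hs, gPotential, ht] at h1
    simp only [hlog, hg.inverse a ha] at h1
    have e : ∑ i, legendre (radial n f) a i * (2 * a i - 1 - deriv F t) =
        2 * ∑ i, legendre (radial n f) a i * a i - t * (1 + deriv F t) := by
      rw [← ht, Finset.mul_sum, Finset.sum_mul, ← Finset.sum_sub_distrib]
      exact Finset.sum_congr rfl fun i _ => by ring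
    rw [e] at h1
    linarith

/-! ### Kähler potentials with a prescribed function `F` -/

/-- If `F(t) = t ln (s / t) - 2 f(s)` with `F'' > -1/t`, then `t = 2 s f'(s)` has positive
derivative. As `s(t)` is not known to be differentiable beforehand, only derivatives in `s` are
taken: `(F'(t) - ln s + ln t + 1) dt/ds = 0`. Since `t` is injective, the zeros of `dt/ds` have
empty interior, so `F'(t) = ln s - ln t - 1` by continuity, and a further differentiation gives
`(F''(t) + 1/t) dt/ds = 1/s > 0`. -/
theorem isRadialPotential_of_tPotential {f : ℝ → ℝ} {J : Set ℝ} (hJ : IsPosInterval J)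
    (hf : ContDiffOn ℝ ∞ f J) (hinj : InjOn (tCoord f) J) (hpos : tRange f J ⊆ Ioi 0)
    (hF : ContDiffOn ℝ ∞ (tPotential f J) (tRange f J))
    (hF2 : ∀ t ∈ tRange f J, -(1 / t) < iteratedDeriv 2 (tPotential f J) t) :
    IsRadialPotential f J := by
  have hT := contDiffOn_tCoord hJ.1 hf
  have hI : IsOpen (tRange f J) := isOpen_image_of_injOn hJ.1 hT.continuousOn hinj
  have hs0 : ∀ s ∈ J, 0 < s := fun s hs => hJ.2.2.2 hs
  have ht0 : ∀ s ∈ J, 0 < tCoord f s := fun s hs => hpos (mem_image_of_mem _ hs)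
  have hmaps : MapsTo (tCoord f) J (tRange f J) := mapsTo_image _ _
  have hTd : ∀ s ∈ J, HasDerivAt (tCoord f) (deriv (tCoord f) s) s := fun s hs =>
    hasDerivAt_of_contDiffOn hJ.1 hT hs
  set F := tPotential f J with hFdef
  have hFT : ∀ s ∈ J, F (tCoord f s) =
      tCoord f s * Real.log (s / tCoord f s) - 2 * f s := fun s hs => by
    rw [hFdef, tPotential, show sOf f J (tCoord f s) = s from hinj.leftInvOn_invFunOn hs]
  let D : ℝ → ℝ := fun s => deriv F (tCoord f s) - (Real.log s - Real.log (tCoord f s) - 1)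
  have hDc : ContinuousOn D J :=
    ((contDiffOn_deriv_infty hI hF).continuousOn.comp hT.continuousOn hmaps).sub
      (((continuousOn_id.log fun s hs => (hs0 s hs).ne').sub
        (hT.continuousOn.log fun s hs => (ht0 s hs).ne')).sub continuousOn_const)
  have hDT : ∀ s ∈ J, D s * deriv (tCoord f) s = 0 := by
    intro s hs
    have hs' := (hs0 s hs).ne'
    have ht' := (ht0 s hs).ne'
    have h1 : HasDerivAt (F ∘ tCoord f) _ s :=
      (hasDerivAt_of_contDiffOn hI hF (hmaps hs)).comp s (hTd s hs)
    have h2 := ((hTd s hs).mul (((hasDerivAt_id s).div (hTd s hs) ht').log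
      (div_pos (hs0 s hs) (ht0 s hs)).ne')).sub
      ((hasDerivAt_of_contDiffOn hJ.1 hf hs).const_mul 2)
    have h3 := h1.unique (h2.congr_of_eventuallyEq
      (by filter_upwards [hJ.1.mem_nhds hs] with x hx using hFT x hx))
    have hf' : 2 * deriv f s = tCoord f s / s := by rw [tCoord]; field_simp
    rw [hf'] at h3
    simp only [Pi.div_apply, id] at h3
    rw [Real.log_div hs' ht'] at h3
    simp only [D]
    rw [sub_mul, h3]
    field_simp
    ring
  have hD0 : ∀ s ∈ J, D s = 0 := by
    intro s hs
    by_contra hne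
    have hev : ∀ᶠ x in 𝓝 s, x ∈ J ∧ D x ≠ 0 :=
      (hJ.1.eventually_mem hs).and ((hDc.continuousAt (hJ.1.mem_nhds hs)).eventually_ne hne)
    obtain ⟨ε, hε, hball⟩ := Metric.eventually_nhds_iff_ball.mp hev
    have hmem : ∀ x ∈ Metric.ball s ε, x ∈ J := fun x hx => (hball x hx).1
    have hconst : ∀ x ∈ Metric.ball s ε, tCoord f x = tCoord f s := fun x hx =>
      Metric.isOpen_ball.is_const_of_deriv_eq_zero (convex_ball s ε).isPreconnected
        (fun y hy => (hTd y (hmem y hy)).differentiableAt.differentiableWithinAt)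
        (fun y hy => (mul_eq_zero.mp (hDT y (hmem y hy))).resolve_left (hball y hy).2)
        hx (Metric.mem_ball_self hε)
    have hx : s + ε / 2 ∈ Metric.ball s ε := by
      rw [Metric.mem_ball, Real.dist_eq, abs_lt]
      constructor <;> linarith
    have := hinj (hmem _ hx) hs (hconst _ hx)
    linarith
  refine ⟨hJ, hf, fun s hs => ?_, fun s hs => ?_⟩
  · exact (mul_pos_iff_of_pos_left (mul_pos two_pos (hs0 s hs))).mp (ht0 s hs)
  · have hs' := hs0 s hs
    have ht' := ht0 s hs
    have h1 : HasDerivAt (deriv F ∘ tCoord f) _ s :=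
      (hasDerivAt_of_contDiffOn hI (contDiffOn_deriv_infty hI hF) (hmaps hs)).comp s (hTd s hs)
    have h2 := ((Real.hasDerivAt_log hs'.ne').sub ((hTd s hs).log ht'.ne')).sub_const 1
    have h3 := h1.unique (h2.congr_of_eventuallyEq
      (by filter_upwards [hJ.1.mem_nhds hs] with x hx using sub_eq_zero.mp (hD0 x hx)))
    have h4 := hF2 _ (hmaps hs)
    rw [iteratedDeriv_succ, iteratedDeriv_one] at h4
    have h5 : (deriv (deriv F) (tCoord f s) + 1 / tCoord f s) * deriv (tCoord f) s = s⁻¹ := by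
      rw [add_mul, h3]
      ring
    exact (mul_pos_iff_of_pos_left (by linarith)).mp (h5.symm ▸ inv_pos.mpr hs')

/-- The variable `s = t e^{1 + F'(t)}`, as a function of `t`. -/
def sFrom (F : ℝ → ℝ) (t : ℝ) : ℝ := t * Real.exp (1 + deriv F t)

/-- The radial Kähler potential `f(s) = (t (1 + F'(t)) - F(t)) / 2` with `s = t e^{1 + F'(t)}`. -/
def potentialFrom (F : ℝ → ℝ) (I : Set ℝ) (s : ℝ) : ℝ :=
  (Function.invFunOn (sFrom F) I s * (1 + deriv F (Function.invFunOn (sFrom F) I s)) -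
    F (Function.invFunOn (sFrom F) I s)) / 2

section

variable {F : ℝ → ℝ} {I : Set ℝ} {t : ℝ}

theorem contDiffOn_sFrom (hI : IsOpen I) (hF : ContDiffOn ℝ ∞ F I) :
    ContDiffOn ℝ ∞ (sFrom F) I :=
  contDiffOn_id.mul (contDiffOn_const.add (contDiffOn_deriv_infty hI hF)).exp

theorem sFrom_pos (ht : 0 < t) : 0 < sFrom F t := mul_pos ht (Real.exp_pos _)

theorem deriv_sFrom (hI : IsOpen I) (hF : ContDiffOn ℝ ∞ F I) (ht : t ∈ I) :
    deriv (sFrom F) t = Real.exp (1 + deriv F t) * (1 + t * deriv (deriv F) t) := by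
  have h := (hasDerivAt_id t).mul
    ((hasDerivAt_of_contDiffOn hI (contDiffOn_deriv_infty hI hF) ht).const_add 1).exp
  refine h.deriv.trans ?_
  simp only [id]
  ring

theorem one_add_mul_pos_of_neg_inv_lt (ht : 0 < t) (hF2 : -(1 / t) < iteratedDeriv 2 F t) :
    0 < 1 + t * deriv (deriv F) t := by
  rw [iteratedDeriv_succ, iteratedDeriv_one] at hF2
  have h := mul_lt_mul_of_pos_left hF2 ht
  rw [mul_neg, mul_one_div_cancel ht.ne'] at h
  linarith

variable (hI : IsPosInterval I) (hF : ContDiffOn ℝ ∞ F I)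
  (hF2 : ∀ t ∈ I, -(1 / t) < iteratedDeriv 2 F t)

include hI hF hF2

theorem deriv_sFrom_pos (ht : t ∈ I) : 0 < deriv (sFrom F) t := by
  rw [deriv_sFrom hI.1 hF ht]
  exact mul_pos (Real.exp_pos _) (one_add_mul_pos_of_neg_inv_lt (hI.2.2.2 ht) (hF2 t ht))

theorem injOn_sFrom : InjOn (sFrom F) I :=
  injOn_of_deriv_pos hI.2.1 (contDiffOn_sFrom hI.1 hF).continuousOn fun _ ht =>
    deriv_sFrom_pos hI hF hF2 ht

theorem potentialFrom_sFrom (ht : t ∈ I) :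
    potentialFrom F I (sFrom F t) = (t * (1 + deriv F t) - F t) / 2 := by
  rw [potentialFrom, (injOn_sFrom hI hF hF2).leftInvOn_invFunOn ht]

theorem tCoord_potentialFrom (ht : t ∈ I) : tCoord (potentialFrom F I) (sFrom F t) = t := by
  have hS := hasStrictDerivAt_of_contDiffOn hI.1 (contDiffOn_sFrom hI.1 hF) ht
  have hK := (((hasDerivAt_id t).mul ((hasDerivAt_of_contDiffOn hI.1
    (contDiffOn_deriv_infty hI.1 hF) ht).const_add 1)).sub
    (hasDerivAt_of_contDiffOn hI.1 hF ht)).div_const 2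
  have hd := hasDerivAt_of_comp_eq hI.1 hS (deriv_sFrom_pos hI hF hF2 ht).ne' ht
    (fun x hx => potentialFrom_sFrom hI hF hF2 hx) hK
  have h0 := (one_add_mul_pos_of_neg_inv_lt (hI.2.2.2 ht) (hF2 t ht)).ne'
  rw [tCoord, hd.deriv, deriv_sFrom hI.1 hF ht, sFrom]
  simp only [id]
  have he := (Real.exp_pos (1 + deriv F t)).ne'
  field_simp
  ring

theorem isRadialPotential_potentialFrom :
    IsRadialPotential (potentialFrom F I) (sFrom F '' I) := by
  have hS := contDiffOn_sFrom hI.1 hF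
  have hJ : IsPosInterval (sFrom F '' I) := hI.image hS.continuousOn (injOn_sFrom hI hF hF2)
    fun t ht => sFrom_pos (hI.2.2.2 ht)
  refine ⟨hJ, ?_, ?_, ?_⟩
  · exact contDiffOn_of_comp_eq hI.1 hS (fun t ht => (deriv_sFrom_pos hI hF hF2 ht).ne')
      (fun x hx => potentialFrom_sFrom hI hF hF2 hx)
      (((contDiffOn_id.mul (contDiffOn_const.add (contDiffOn_deriv_infty hI.1 hF))).sub hF).div_const
        2)
  · rintro _ ⟨t, ht, rfl⟩
    have h := tCoord_potentialFrom hI hF hF2 ht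
    rw [tCoord] at h
    have ht0 : 0 < t := hI.2.2.2 ht
    exact (mul_pos_iff_of_pos_left (mul_pos two_pos (sFrom_pos (F := F) ht0))).mp
      (h.symm ▸ ht0)
  · rintro _ ⟨t, ht, rfl⟩
    rw [(hasDerivAt_of_comp_eq hI.1 (hasStrictDerivAt_of_contDiffOn hI.1 hS ht)
      (deriv_sFrom_pos hI hF hF2 ht).ne' ht (fun x hx => tCoord_potentialFrom hI hF hF2 hx)
      (hasDerivAt_id t)).deriv]
    exact one_div_pos.mpr (deriv_sFrom_pos hI hF hF2 ht)

theorem tRange_potentialFrom : tRange (potentialFrom F I) (sFrom F '' I) = I := by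
  rw [tRange, image_image, image_congr fun t ht => tCoord_potentialFrom hI hF hF2 ht, image_id']

theorem potentialFrom_legendre {s : ℝ} (hs : s ∈ sFrom F '' I) :
    F (tCoord (potentialFrom F I) s) = tCoord (potentialFrom F I) s *
      Real.log (s / tCoord (potentialFrom F I) s) - 2 * potentialFrom F I s := by
  obtain ⟨t, ht, rfl⟩ := hs
  have ht0 : t ≠ 0 := (hI.2.2.2 ht).ne'
  rw [tCoord_potentialFrom hI hF hF2 ht, potentialFrom_sFrom hI hF hF2 ht, sFrom,
    mul_div_cancel_left₀ _ ht0, Real.log_exp]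
  ring

theorem eqOn_tPotential_potentialFrom :
    EqOn (tPotential (potentialFrom F I) (sFrom F '' I)) F I := by
  intro t ht
  have h := isRadialPotential_potentialFrom hI hF hF2
  have hs := mem_image_of_mem (sFrom F) ht
  have h1 := h.tPotential_tCoord hs
  rwa [← potentialFrom_legendre hI hF hF2 hs, tCoord_potentialFrom hI hF hF2 ht] at h1

theorem isSymplecticPotential_potentialFrom {n : ℕ} :
    IsSymplecticPotential (radial n (potentialFrom F I)) (shell n (sFrom F '' I))
      (orthantPart n I) (gPotential n F) := by
  have h := (isRadialPotential_potentialFrom hI hF hF2).isSymplecticPotential (n := n)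
    (fun s hs => potentialFrom_legendre hI hF hF2 hs)
    (by rwa [tRange_potentialFrom hI hF hF2])
  rwa [tRange_potentialFrom hI hF hF2] at h

theorem eq_potentialFrom_of_isSymplecticPotential {n : ℕ} (hn : 1 ≤ n) {J' : Set ℝ} {f' : ℝ → ℝ}
    (hJ' : IsPosInterval J') (hf' : ContDiffOn ℝ ∞ f' J')
    (hg : IsSymplecticPotential (radial n f') (shell n J') (orthantPart n I) (gPotential n F)) :
    J' = sFrom F '' I ∧ EqOn f' (potentialFrom F I) (sFrom F '' I) := by
  have hn0 : (0 : ℝ) < n := by exact_mod_cast hn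
  -- points with equal coordinates suffice, both for `a` and for `x`
  have hsub : J' ⊆ sFrom F '' I := by
    intro s hs
    have hs0 : 0 < s := hJ'.2.2.2 hs
    have hsum : ∑ _i : Fin n, Real.exp (2 * (1 / 2 * Real.log (s / n))) = s := by
      rw [Finset.sum_const, Finset.card_univ, Fintype.card_fin,
        exp_two_mul_half_log (div_pos hs0 hn0), nsmul_eq_mul]
      field_simp
    obtain ⟨ht, hst, -⟩ := eq_of_isSymplecticPotential hJ' hI.1 hf' hF hg
      (a := fun _ => 1 / 2 * Real.log (s / n)) (mem_logDomain_shell.mpr (hsum.symm ▸ hs)) hsum rfl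
    exact ⟨_, ht, hst.symm⟩
  have hsup : ∀ t ∈ I, sFrom F t ∈ J' ∧ f' (sFrom F t) = potentialFrom F I (sFrom F t) := by
    intro t ht
    have ht0 : 0 < t := hI.2.2.2 ht
    have hsum : ∑ _i : Fin n, t / n = t := by
      rw [Finset.sum_const, Finset.card_univ, Fintype.card_fin, nsmul_eq_mul]
      field_simp
    obtain ⟨a, ha, hax⟩ := hg.bijOn.surjOn
      (show (fun _ => t / n) ∈ orthantPart n I from ⟨fun _ => div_pos ht0 hn0, hsum.symm ▸ ht⟩)
    obtain ⟨-, hst, hft⟩ := eq_of_isSymplecticPotential hJ' hI.1 hf' hF hg ha rfl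
      (hax ▸ hsum : ∑ i, legendre (radial n f') a i = t)
    have hmem := mem_logDomain_shell.mp ha
    rw [hst] at hmem hft
    refine ⟨hmem, ?_⟩
    rw [potentialFrom_sFrom hI hF hF2 ht]
    exact (eq_div_iff two_ne_zero).mpr ((mul_comm _ _).trans hft)
  exact ⟨hsub.antisymm (image_subset_iff.mpr fun t ht => (hsup t ht).1),
    forall_mem_image.mpr fun t ht => (hsup t ht).2⟩

end

end ToricKahler

end

theorem theorem4 (n : ℕ) (hn : 1 ≤ n) :
    -- a radial Kähler metric has the stated symplectic potential and scalar curvature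
    (∀ (J : Set ℝ) (f : ℝ → ℝ), ToricKahler.IsPosInterval J → ContDiffOn ℝ ∞ f J →
      ToricKahler.IsKahlerPotentialOn (ToricKahler.radial n f) (ToricKahler.shell n J) →
      (n = 1 → ∀ s ∈ J, 0 < deriv f s) →
        ToricKahler.IsSUInvariantOn (ToricKahler.radial n f) (ToricKahler.shell n J) ∧
        ToricKahler.IsPosInterval (ToricKahler.tRange f J) ∧
        Set.BijOn (ToricKahler.tCoord f) J (ToricKahler.tRange f J) ∧
        ContDiffOn ℝ ∞ (ToricKahler.sOf f J) (ToricKahler.tRange f J) ∧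
        ContDiffOn ℝ ∞ (ToricKahler.tPotential f J) (ToricKahler.tRange f J) ∧
        (∀ t ∈ ToricKahler.tRange f J,
          -(1 / t) < iteratedDeriv 2 (ToricKahler.tPotential f J) t) ∧
        ToricKahler.IsSymplecticPotential (ToricKahler.radial n f) (ToricKahler.shell n J)
          (ToricKahler.orthantPart n (ToricKahler.tRange f J))
          (ToricKahler.gPotential n (ToricKahler.tPotential f J)) ∧
        (∀ a ∈ ToricKahler.logDomain (ToricKahler.shell n J),
          ∑ i, ToricKahler.legendre (ToricKahler.radial n f) a i =
            ToricKahler.tCoord f (∑ i, Real.exp (2 * a i))) ∧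
        (∀ z ∈ ToricKahler.shell n J, ∀ t : ℝ, t = ToricKahler.tCoord f (∑ i, ‖z i‖ ^ 2) →
          ToricKahler.scalarCurvature (ToricKahler.radial n f) z =
            ((t ^ (1 - (n : ℤ)) *
              iteratedDeriv 2 (fun τ : ℝ => τ ^ (n + 1) *
                iteratedDeriv 2 (ToricKahler.tPotential f J) τ /
                  (1 + τ * iteratedDeriv 2 (ToricKahler.tPotential f J) τ)) t : ℝ) : ℂ))) ∧
    -- converse, for a function `F` that comes from some radial function `f`
    (∀ (J : Set ℝ) (f : ℝ → ℝ), ToricKahler.IsPosInterval J → ContDiffOn ℝ ∞ f J →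
      Set.InjOn (ToricKahler.tCoord f) J →
      ToricKahler.tRange f J ⊆ Set.Ioi 0 →
      ContDiffOn ℝ ∞ (ToricKahler.tPotential f J) (ToricKahler.tRange f J) →
      (∀ t ∈ ToricKahler.tRange f J,
        -(1 / t) < iteratedDeriv 2 (ToricKahler.tPotential f J) t) →
        ToricKahler.IsKahlerPotentialOn (ToricKahler.radial n f) (ToricKahler.shell n J)) ∧
    -- converse, for an arbitrary function `F` on an interval
    (∀ (I : Set ℝ) (F : ℝ → ℝ), ToricKahler.IsPosInterval I → ContDiffOn ℝ ∞ F I →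
      (∀ t ∈ I, -(1 / t) < iteratedDeriv 2 F t) →
        ∃ (J : Set ℝ) (f : ℝ → ℝ),
          J = (fun t => t * Real.exp (1 + deriv F t)) '' I ∧
          ToricKahler.IsPosInterval J ∧ ContDiffOn ℝ ∞ f J ∧
          ToricKahler.IsKahlerPotentialOn (ToricKahler.radial n f) (ToricKahler.shell n J) ∧
          ToricKahler.IsSUInvariantOn (ToricKahler.radial n f) (ToricKahler.shell n J) ∧
          ToricKahler.tRange f J = I ∧
          Set.EqOn (ToricKahler.tPotential f J) F I ∧
          ToricKahler.IsSymplecticPotential (ToricKahler.radial n f) (ToricKahler.shell n J)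
            (ToricKahler.orthantPart n I) (ToricKahler.gPotential n F) ∧
          (∀ (J' : Set ℝ) (f' : ℝ → ℝ), ToricKahler.IsPosInterval J' → ContDiffOn ℝ ∞ f' J' →
            ToricKahler.IsKahlerPotentialOn (ToricKahler.radial n f') (ToricKahler.shell n J') →
            ToricKahler.IsSymplecticPotential (ToricKahler.radial n f') (ToricKahler.shell n J')
              (ToricKahler.orthantPart n I) (ToricKahler.gPotential n F) →
              J' = J ∧ Set.EqOn f' f J)) := by
  refine ⟨fun J f hJ hf hK h1 => ?_, fun J f hJ hf hinj hpos hF hF2 => ?_, fun I F hI hF hF2 => ?_⟩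
  · have h := hK.isRadialPotential hn hJ hf h1
    refine ⟨h.isSUInvariantOn, h.isPosInterval_tRange, h.bijOn_tCoord, h.contDiffOn_sOf,
      h.contDiffOn_tPotential, ?_,
      h.isSymplecticPotential (fun s hs => h.tPotential_tCoord hs) h.contDiffOn_tPotential,
      fun a ha => ?_, fun z hz t ht => h.scalarCurvature_eq hn hz ht⟩
    · rintro _ ⟨s, hs, rfl⟩
      rw [h.iteratedDeriv_two_potential (fun x hx => h.tPotential_tCoord hx) hs]
      linarith [one_div_pos.mpr (mul_pos (h.pos hs) (h.deriv_tCoord_pos s hs))]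
    · exact ToricKahler.sum_legendre_radial (ToricKahler.hasDerivAt_of_contDiffOn hJ.1 hf
        (ToricKahler.mem_logDomain_shell.mp ha)).differentiableAt
  · exact (ToricKahler.isRadialPotential_of_tPotential hJ hf hinj hpos hF hF2).isKahlerPotentialOn
  · have h := ToricKahler.isRadialPotential_potentialFrom hI hF hF2
    exact ⟨_, ToricKahler.potentialFrom F I, rfl, h.interval, h.smooth, h.isKahlerPotentialOn,
      h.isSUInvariantOn, ToricKahler.tRange_potentialFrom hI hF hF2,
      ToricKahler.eqOn_tPotential_potentialFrom hI hF hF2,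
      ToricKahler.isSymplecticPotential_potentialFrom hI hF hF2, fun J' f' hJ' hf' _ hg =>
        ToricKahler.eq_potentialFrom_of_isSymplecticPotential hI hF hF2 hn hJ' hf' hg⟩
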